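/- For a finite group $G$, let $\mathrm{rd}(G)$ be the smallest positive integer $r$ such that $G$ is isomorphic to a subgroup of $\mathrm{GL}_r(\mathbb{C})$, and let $\mathrm{ed}(G)$ be the minimal dimension of a faithful linearizable $G$-variety. Here a faithful $G$-variety is a complex algebraic variety $X$ with a faithful action of $G$, and $X$ is linearizable if there is a $G$-equivariant dominant rational map $V \dashrightarrow X$, where $V$ is a finite-dimensional complex vector space with a linear action of $G$. For every real number $\varepsilon > 0$ there exists a nontrivial finite group $G$ such that $$\frac{\mathrm{ed}(G)}{\mathrm{rd}(G)} < \varepsilon .$$ More precisely, write $C_q$ for the cyclic group $\mathbb{Z}/q\mathbb{Z}$, $C_q^*$ for $(\mathbb{Z}/q\mathbb{Z})^*$ acting on $C_q$ by multiplication, and $\phi$ for Euler's function. For every $\varepsilon > 0$ there is an $r_0$ such that for every $r \geq r_0$, with $a = p_1 p_2 \cdots p_r$ the product of the first $r$ primes, there exists a prime $q \equiv 1 \pmod a$, and for every such prime $q$ the finite group $G = C_q \rtimes C_q^*$ satisfies $$\mathrm{rd}(G) = q-1, \qquad \mathrm{ed}(G) \leq \phi(q-1), \qquad \frac{\mathrm{ed}(G)}{\mathrm{rd}(G)}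 < \varepsilon .$$ -/

import Mathlib

open CategoryTheory AlgebraicGeometry

/-! ### Varieties with a group action over the complex numbers -/

/-- A complex algebraic variety (an integral separated scheme of finite type over `ℂ`) equipped
with an action of the group `G` by automorphisms over `ℂ`.  Multiplication in `Aut` is
`a * b = b ≫ a`, so that a homomorphism `G →* Aut X` is a left action. -/
structure GVariety (G : Type*) [Group G] where
  /-- The underlying scheme. -/
  carrier : Scheme.{0}
  /-- The structure morphism. -/
  str : carrier ⟶ Spec (CommRingCat.of ℂ)
  isIntegral : IsIntegral carrier
  isSeparated : IsSeparated str
  locallyOfFiniteType : LocallyOfFiniteType str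
  quasiCompact : QuasiCompact str
  /-- The action. -/
  act : G →* Aut carrier
  act_str : ∀ g : G, (act g).hom ≫ str = str

attribute [instance] GVariety.isIntegral GVariety.isSeparated GVariety.locallyOfFiniteType
  GVariety.quasiCompact

namespace GVariety

variable {G : Type*} [Group G]

/-- The action is faithful: only the identity of `G` acts trivially. -/
def IsFaithful (X : GVariety G) : Prop := Function.Injective X.act

/-- An automorphism is dominant as a rational map. -/
instance isDominant_act (X : GVariety G) (g : G) :
    (Scheme.Hom.toRationalMap (X.act g).hom).IsDominant := by
  rw [Scheme.PartialMap.isDominant_toRationalMap_iff]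
  have : IsIso (X.act g).hom := Iso.isIso_hom (X.act g)
  have : IsDominant (X.act g).hom := inferInstance
  exact inferInstanceAs (IsDominant (Scheme.Hom.toPartialMap (X.act g).hom).hom)

/-- A rational map of `ℂ`-varieties is `G`-equivariant: it commutes with the structure morphisms
to `Spec ℂ`, and `f ∘ g = g ∘ f` as rational maps, for every `g` in `G`. -/
structure IsEquivariant (V X : GVariety G) (f : V.carrier ⤏ X.carrier) : Prop where
  comm_str : f.compHom X.str = Scheme.Hom.toRationalMap V.str
  comm_act : ∀ g : G,
    (Scheme.Hom.toRationalMap (V.act g).hom).comp f = f.compHom (X.act g).hom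

end GVariety

/-! ### Linear actions on affine space -/

/-- The pullback of polynomial functions along the linear map `v ↦ A v` of `ℂⁿ`:
the coordinate `Xᵢ` goes to `∑ⱼ Aᵢⱼ Xⱼ`. -/
noncomputable def linPullback {n : ℕ} (A : Matrix (Fin n) (Fin n) ℂ) :
    MvPolynomial (Fin n) ℂ →ₐ[ℂ] MvPolynomial (Fin n) ℂ :=
  MvPolynomial.aeval fun i => ∑ j, MvPolynomial.C (A i j) * MvPolynomial.X j

theorem linPullback_one (n : ℕ) :
    linPullback (1 : Matrix (Fin n) (Fin n) ℂ) = AlgHom.id ℂ _ := by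
  ext i
  simp [linPullback, Matrix.one_apply, apply_ite, ite_mul]

theorem linPullback_mul {n : ℕ} (A B : Matrix (Fin n) (Fin n) ℂ) :
    linPullback (A * B) = (linPullback B).comp (linPullback A) := by
  apply MvPolynomial.algHom_ext
  intro i
  simp only [linPullback, MvPolynomial.aeval_X, AlgHom.comp_apply, map_sum, map_mul,
    MvPolynomial.algHom_C, MvPolynomial.algebraMap_eq, Matrix.mul_apply, Finset.sum_mul,
    Finset.mul_sum]
  rw [Finset.sum_comm]
  simp only [mul_assoc]

/-- The automorphism `v ↦ ρ(g) v` of the affine space `ℂⁿ`. -/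
noncomputable def linAct {G : Type*} [Group G] {n : ℕ}
    (ρ : G →* Matrix.GeneralLinearGroup (Fin n) ℂ) :
    G →* Aut (Spec (CommRingCat.of (MvPolynomial (Fin n) ℂ))) where
  toFun g :=
    { hom := Spec.map (CommRingCat.ofHom (linPullback (ρ g).val).toRingHom)
      inv := Spec.map (CommRingCat.ofHom (linPullback (ρ g⁻¹).val).toRingHom)
      hom_inv_id := by
        rw [← Spec.map_comp, ← CommRingCat.ofHom_comp]
        change Spec.map (CommRingCat.ofHom
          ((linPullback (ρ g).val).comp (linPullback (ρ g⁻¹).val)).toRingHom) = _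
        rw [← linPullback_mul, ← Units.val_mul, ← map_mul, inv_mul_cancel, map_one, Units.val_one,
          linPullback_one]
        exact Spec.map_id _
      inv_hom_id := by
        rw [← Spec.map_comp, ← CommRingCat.ofHom_comp]
        change Spec.map (CommRingCat.ofHom
          ((linPullback (ρ g⁻¹).val).comp (linPullback (ρ g).val)).toRingHom) = _
        rw [← linPullback_mul, ← Units.val_mul, ← map_mul, mul_inv_cancel, map_one, Units.val_one,
          linPullback_one]
        exact Spec.map_id _ }
  map_one' := by
    apply Iso.ext
    change Spec.map (CommRingCat.ofHom (linPullback (ρ 1).val).toRingHom) = _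
    rw [map_one, Units.val_one, linPullback_one]
    exact Spec.map_id _
  map_mul' g h := by
    apply Iso.ext
    change Spec.map (CommRingCat.ofHom (linPullback (ρ (g * h)).val).toRingHom) =
      Spec.map (CommRingCat.ofHom (linPullback (ρ h).val).toRingHom) ≫
        Spec.map (CommRingCat.ofHom (linPullback (ρ g).val).toRingHom)
    rw [map_mul, Units.val_mul, linPullback_mul, ← Spec.map_comp, ← CommRingCat.ofHom_comp]
    rfl

/-- The affine space `ℂⁿ` with the linear action of `G` through `ρ : G → GLₙ(ℂ)`. -/
noncomputable def linVariety {G : Type*} [Group G] {n : ℕ}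
    (ρ : G →* Matrix.GeneralLinearGroup (Fin n) ℂ) : GVariety G where
  carrier := Spec (CommRingCat.of (MvPolynomial (Fin n) ℂ))
  str := Spec.map (CommRingCat.ofHom (algebraMap ℂ (MvPolynomial (Fin n) ℂ)))
  isIntegral := inferInstance
  isSeparated := inferInstance
  locallyOfFiniteType := by
    rw [HasRingHomProperty.Spec_iff (P := @LocallyOfFiniteType)]
    exact (RingHom.finiteType_algebraMap (A := ℂ) (B := MvPolynomial (Fin n) ℂ)).mpr inferInstance
  quasiCompact := inferInstance
  act := linAct ρ
  act_str g := by
    change Spec.map (CommRingCat.ofHom (linPullback (ρ g).val).toRingHom) ≫ _ = _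
    rw [← Spec.map_comp, ← CommRingCat.ofHom_comp]
    congr 2
    exact (linPullback (ρ g).val).comp_algebraMap

/-! ### Linearizable varieties, essential dimension, representation dimension -/

/-- A `G`-variety `X` is linearizable if there is a `G`-equivariant dominant rational map to `X`
from a finite-dimensional complex vector space with a linear action of `G`. -/
def GVariety.IsLinearizable {G : Type*} [Group G] (X : GVariety G) : Prop :=
  ∃ (n : ℕ) (ρ : G →* Matrix.GeneralLinearGroup (Fin n) ℂ)
    (f : (linVariety ρ).carrier ⤏ X.carrier),
    f.IsDominant ∧ (linVariety ρ).IsEquivariant X f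

/-- The natural number `d` is the dimension of some faithful linearizable `G`-variety. -/
def IsDimOfFaithfulLinearizable (G : Type*) [Group G] (d : ℕ) : Prop :=
  ∃ X : GVariety G, X.IsFaithful ∧ X.IsLinearizable ∧ topologicalKrullDim X.carrier = d

/-- The essential dimension of a finite group: the minimal dimension of a faithful linearizable
`G`-variety. -/
noncomputable def essentialDim (G : Type*) [Group G] : ℕ :=
  sInf {d | IsDimOfFaithfulLinearizable G d}

/-- The representation dimension of a finite group: the smallest positive integer `r` such that
`G` is isomorphic to a subgroup of `GLᵣ(ℂ)`. -/
noncomputable def representationDim (G : Type*) [Group G] : ℕ :=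
  sInf {r | 0 < r ∧ ∃ ρ : G →* Matrix.GeneralLinearGroup (Fin r) ℂ, Function.Injective ρ}

/-! The two minima are taken over nonempty sets. -/

theorem exists_faithful_rep (G : Type*) [Group G] [Finite G] :
    ∃ r, 0 < r ∧ ∃ ρ : G →* Matrix.GeneralLinearGroup (Fin r) ℂ, Function.Injective ρ := by
  obtain ⟨n, ⟨e⟩⟩ := Finite.exists_equiv_fin G
  let τ : G →* Equiv.Perm (Fin n) := (e.permCongrHom).toMonoidHom.comp (MulAction.toPermHom G G)
  have hτ : Function.Injective τ :=
    e.permCongrHom.injective.comp MulAction.toPerm_injective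
  let σ : Equiv.Perm (Fin n) →* Matrix (Fin n) (Fin n) ℂ :=
    { toFun := fun p => p⁻¹.permMatrix ℂ
      map_one' := by simp
      map_mul' := fun p p' => by simp [mul_inv_rev, Matrix.permMatrix_mul] }
  have hσ : Function.Injective σ := by
    intro p p' h
    have h1 : p⁻¹ = p'⁻¹ := by
      ext i
      have h2 := congrFun (congrFun h i) (p⁻¹ i)
      have h3 : p'⁻¹ i = p⁻¹ i := by
        simpa [σ, Equiv.Perm.permMatrix, PEquiv.toMatrix_apply] using h2
      rw [h3]
    exact inv_injective h1
  refine ⟨n, ?_, (σ.comp τ).toHomUnits, ?_⟩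
  · exact (e 1).pos
  · intro a b h
    exact hτ (hσ (congrArg Units.val h))

theorem linVariety_isFaithful {G : Type*} [Group G] {n : ℕ}
    (ρ : G →* Matrix.GeneralLinearGroup (Fin n) ℂ) (hρ : Function.Injective ρ) :
    (linVariety ρ).IsFaithful := by
  intro a b h
  apply hρ
  have h1 : Spec.map (CommRingCat.ofHom (linPullback (ρ a).val).toRingHom) =
      Spec.map (CommRingCat.ofHom (linPullback (ρ b).val).toRingHom) := congrArg Iso.hom h
  have h2 := congrArg CommRingCat.Hom.hom (Spec.map_injective h1)
  ext i j
  have h3 : linPullback (ρ a).val (MvPolynomial.X i) = linPullback (ρ b).val (MvPolynomial.X i) :=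
    RingHom.congr_fun h2 (MvPolynomial.X i)
  have h4 := congrArg (MvPolynomial.eval (Pi.single j (1 : ℂ))) h3
  simpa [linPullback, Pi.single_apply] using h4

theorem linVariety_isLinearizable {G : Type*} [Group G] {n : ℕ}
    (ρ : G →* Matrix.GeneralLinearGroup (Fin n) ℂ) : (linVariety ρ).IsLinearizable := by
  refine ⟨n, ρ, Scheme.RationalMap.id _, inferInstance, ⟨?_, fun g => ?_⟩⟩
  · rw [Scheme.RationalMap.id_compHom]
  · rw [Scheme.RationalMap.id_compHom]
    exact Scheme.RationalMap.comp_id _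

theorem exists_isDimOfFaithfulLinearizable (G : Type*) [Group G] [Finite G] :
    ∃ d, IsDimOfFaithfulLinearizable G d := by
  obtain ⟨n, -, ρ, hρ⟩ := exists_faithful_rep G
  refine ⟨n, linVariety ρ, linVariety_isFaithful ρ hρ, linVariety_isLinearizable ρ, ?_⟩
  change topologicalKrullDim (PrimeSpectrum (MvPolynomial (Fin n) ℂ)) = n
  rw [PrimeSpectrum.topologicalKrullDim_eq_ringKrullDim,
    MvPolynomial.ringKrullDim_of_isNoetherianRing, ringKrullDim_eq_zero_of_field]
  simp

/-! ### The groups `C_q ⋊ C_q^*` -/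

/-- The action of `(ℤ/q)ˣ` on the cyclic group `ℤ/q` (written multiplicatively) by
multiplication. -/
def unitsAct (q : ℕ) : (ZMod q)ˣ →* MulAut (Multiplicative (ZMod q)) :=
  MonoidHom.mk' (fun u => AddEquiv.toMultiplicative (AddEquiv.mk (Units.mulLeft u) (mul_add _)))
    (fun u v => by
      ext x
      exact congrArg Multiplicative.ofAdd (mul_assoc (u : ZMod q) v x.toAdd))

theorem unitsAct_apply (q : ℕ) (u : (ZMod q)ˣ) (x : ZMod q) :
    unitsAct q u (Multiplicative.ofAdd x) = Multiplicative.ofAdd ((u : ZMod q) * x) :=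
  rfl

/-- The semidirect product `C_q ⋊ C_q^*`. -/
abbrev CqSemidirect (q : ℕ) : Type :=
  Multiplicative (ZMod q) ⋊[unitsAct q] (ZMod q)ˣ

/-- The partial map represented by a morphism defined on a dense open immersion. -/
noncomputable def partialMapOfOpenImmersion {U X Y : Scheme.{0}} (j : U ⟶ X) [IsOpenImmersion j]
    [IsDominant j] (h : U ⟶ Y) : X.PartialMap Y where
  domain := j.opensRange
  dense_domain := j.denseRange
  hom := j.isoOpensRange.inv ≫ h

theorem partialMapOfOpenImmersion_compHom {U X Y Z : Scheme.{0}} (j : U ⟶ X) [IsOpenImmersion j]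
    [IsDominant j] (h : U ⟶ Y) (f : Y ⟶ Z) :
    (partialMapOfOpenImmersion j h).compHom f = partialMapOfOpenImmersion j (h ≫ f) := by
  unfold partialMapOfOpenImmersion Scheme.PartialMap.compHom
  simp only [Category.assoc]

theorem Scheme.PartialMap.equiv_of_factor {U X Y : Scheme.{0}} (j : U ⟶ X) [IsOpenImmersion j]
    [IsDominant j] (f g : X.PartialMap Y) (kf : U ⟶ f.domain) (kg : U ⟶ g.domain)
    (hf : kf ≫ f.domain.ι = j) (hg : kg ≫ g.domain.ι = j) (h : kf ≫ f.hom = kg ≫ g.hom) :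
    f.equiv g := by
  have aux : ∀ (V : X.Opens) (k : U ⟶ V), k ≫ V.ι = j → ∃ hV : j.opensRange ≤ V,
      X.homOfLE hV = j.isoOpensRange.inv ≫ k := by
    intro V k hk
    refine ⟨?_, ?_⟩
    · rintro _ ⟨x, rfl⟩
      rw [← hk]
      exact (k x).2
    · rw [← cancel_mono V.ι, Scheme.homOfLE_ι, Category.assoc, hk,
        Scheme.Hom.isoOpensRange_inv_comp]
  obtain ⟨hf', ef⟩ := aux _ kf hf
  obtain ⟨hg', eg⟩ := aux _ kg hg
  refine ⟨j.opensRange, j.denseRange, hf', hg', ?_⟩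
  change X.homOfLE hf' ≫ f.hom = X.homOfLE hg' ≫ g.hom
  rw [ef, eg, Category.assoc, Category.assoc, h]

theorem partialMapOfOpenImmersion_self_equiv {U X Y : Scheme.{0}} (j : U ⟶ X) [IsOpenImmersion j]
    [IsDominant j] (f : X ⟶ Y) :
    (partialMapOfOpenImmersion j (j ≫ f)).equiv f.toPartialMap := by
  refine Scheme.PartialMap.equiv_of_factor j _ _ j.isoOpensRange.hom (j ≫ X.topIso.inv)
    j.isoOpensRange_hom_ι ?_ ?_
  · change (j ≫ X.topIso.inv) ≫ (⊤ : X.Opens).ι = j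
    simp
  · change j.isoOpensRange.hom ≫ j.isoOpensRange.inv ≫ j ≫ f =
      (j ≫ X.topIso.inv) ≫ X.topIso.hom ≫ f
    simp

theorem comp_partialMapOfOpenImmersion_equiv {U X Y : Scheme.{0}} [PreirreducibleSpace X]
    [Nonempty X] (j : U ⟶ X) [IsOpenImmersion j] [IsDominant j] (h : U ⟶ Y)
    (f : X.PartialMap X) [IsDominant f.hom] (k : U ⟶ f.domain) (hk : k ≫ f.domain.ι = j)
    (b : U ⟶ U) (hb : b ≫ j = k ≫ f.hom) :
    (f.comp (partialMapOfOpenImmersion j h)).equiv (partialMapOfOpenImmersion j (b ≫ h)) := by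
  let V := f.hom ⁻¹ᵁ j.opensRange
  have hr : Set.range k ⊆ Set.range V.ι := by
    rw [Scheme.Opens.range_ι]
    rintro _ ⟨x, rfl⟩
    change f.hom (k x) ∈ Set.range j
    refine ⟨b x, ?_⟩
    rw [← Scheme.Hom.comp_apply, hb, ← Scheme.Hom.comp_apply]
  let l : U ⟶ V := IsOpenImmersion.lift V.ι k hr
  have hl : l ≫ V.ι = k := IsOpenImmersion.lift_fac _ _ _
  refine Scheme.PartialMap.equiv_of_factor j _ _ (l ≫ (f.domain.ι.isoImage V).hom)
    j.isoOpensRange.hom ?_ j.isoOpensRange_hom_ι ?_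
  · change (l ≫ (f.domain.ι.isoImage V).hom) ≫ (f.domain.ι ''ᵁ V).ι = j
    rw [Category.assoc, Scheme.Hom.isoImage_hom_ι, ← Category.assoc, hl, hk]
  · change (l ≫ (f.domain.ι.isoImage V).hom) ≫ (f.domain.ι.isoImage V).inv ≫
      (f.hom ∣_ j.opensRange) ≫ j.isoOpensRange.inv ≫ h =
      j.isoOpensRange.hom ≫ j.isoOpensRange.inv ≫ b ≫ h
    have : l ≫ (f.hom ∣_ j.opensRange) ≫ j.isoOpensRange.inv = b := by
      rw [← cancel_mono j]
      simp only [Category.assoc, Scheme.Hom.isoOpensRange_inv_comp, morphismRestrict_ι]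
      rw [← Category.assoc, hl, hb]
    rw [← this]
    simp

theorem toPartialMap_comp_partialMapOfOpenImmersion_equiv {U X Y : Scheme.{0}}
    [PreirreducibleSpace X] [Nonempty X] (j : U ⟶ X) [IsOpenImmersion j] [IsDominant j]
    (h : U ⟶ Y) (a : X ⟶ X) [IsDominant a.toPartialMap.hom] (b : U ⟶ U) (hb : b ≫ j = j ≫ a) :
    (a.toPartialMap.comp (partialMapOfOpenImmersion j h)).equiv
      (partialMapOfOpenImmersion j (b ≫ h)) := by
  refine comp_partialMapOfOpenImmersion_equiv j h a.toPartialMap (j ≫ X.topIso.inv) ?_ b ?_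
  · change (j ≫ X.topIso.inv) ≫ (⊤ : X.Opens).ι = j
    simp
  · rw [hb]
    change _ = (j ≫ X.topIso.inv) ≫ X.topIso.hom ≫ a
    simp

theorem isDominant_SpecMap_of_injective {R S : CommRingCat.{0}} (f : R ⟶ S)
    (hf : Function.Injective f.hom) : IsDominant (Spec.map f) := by
  constructor
  change DenseRange (PrimeSpectrum.comap f.hom)
  rw [PrimeSpectrum.denseRange_comap_iff_ker_le_nilRadical,
    (RingHom.injective_iff_ker_eq_bot _).mp hf]
  exact bot_le

section SubalgebraVariety

variable {G : Type*} [Group G] {n : ℕ} (ρ : G →* Matrix.GeneralLinearGroup (Fin n) ℂ)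
  {S : Type} [CommRing S] [IsDomain S] [Algebra ℂ S]
  (A : Subalgebra ℂ S) [Algebra.FiniteType ℂ A] (τ : G → A →ₐ[ℂ] A)
  (hτ1 : τ 1 = AlgHom.id ℂ A) (hτ : ∀ g h, τ (g * h) = (τ h).comp (τ g))

/-- The spectrum of a finitely generated domain with an action of `G`. -/
noncomputable def affineVariety : GVariety G where
  carrier := Spec (CommRingCat.of A)
  str := Spec.map (CommRingCat.ofHom (algebraMap ℂ A))
  isIntegral := inferInstance
  isSeparated := inferInstance
  locallyOfFiniteType := by
    rw [HasRingHomProperty.Spec_iff (P := @LocallyOfFiniteType)]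
    exact (RingHom.finiteType_algebraMap (A := ℂ) (B := A)).mpr inferInstance
  quasiCompact := inferInstance
  act :=
    { toFun g :=
        { hom := Spec.map (CommRingCat.ofHom (τ g).toRingHom)
          inv := Spec.map (CommRingCat.ofHom (τ g⁻¹).toRingHom)
          hom_inv_id := by
            rw [← Spec.map_comp, ← CommRingCat.ofHom_comp]
            change Spec.map (CommRingCat.ofHom ((τ g).comp (τ g⁻¹)).toRingHom) = _
            rw [← hτ, inv_mul_cancel, hτ1]
            exact Spec.map_id _
          inv_hom_id := by
            rw [← Spec.map_comp, ← CommRingCat.ofHom_comp]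
            change Spec.map (CommRingCat.ofHom ((τ g⁻¹).comp (τ g)).toRingHom) = _
            rw [← hτ, mul_inv_cancel, hτ1]
            exact Spec.map_id _ }
      map_one' := by
        apply Iso.ext
        change Spec.map (CommRingCat.ofHom (τ 1).toRingHom) = _
        rw [hτ1]
        exact Spec.map_id _
      map_mul' g h := by
        apply Iso.ext
        change Spec.map (CommRingCat.ofHom (τ (g * h)).toRingHom) =
          Spec.map (CommRingCat.ofHom (τ h).toRingHom) ≫
            Spec.map (CommRingCat.ofHom (τ g).toRingHom)
        rw [hτ, ← Spec.map_comp, ← CommRingCat.ofHom_comp]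
        rfl }
  act_str g := by
    change Spec.map (CommRingCat.ofHom (τ g).toRingHom) ≫ _ = _
    rw [← Spec.map_comp, ← CommRingCat.ofHom_comp]
    congr 2
    exact (τ g).comp_algebraMap

theorem affineVariety_act_eq {a b : G}
    (hab : (affineVariety A τ hτ1 hτ).act a = (affineVariety A τ hτ1 hτ).act b) : τ a = τ b := by
  have h1 : Spec.map (CommRingCat.ofHom (τ a).toRingHom) =
      Spec.map (CommRingCat.ofHom (τ b).toRingHom) := congrArg Iso.hom hab
  have h2 := congrArg CommRingCat.Hom.hom (Spec.map_injective h1)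
  exact AlgHom.ext fun x => RingHom.congr_fun h2 x

theorem affineVariety_isLinearizable [Algebra (MvPolynomial (Fin n) ℂ) S]
    [IsScalarTower ℂ (MvPolynomial (Fin n) ℂ) S] (P : MvPolynomial (Fin n) ℂ) (hP : P ≠ 0)
    [IsLocalization.Away P S] (σ : G → S →ₐ[ℂ] S)
    (hσ : ∀ g p, σ g (algebraMap _ S p) = algebraMap _ S (linPullback (ρ g).val p))
    (hστ : ∀ g (a : A), σ g a = τ g a) :
    (affineVariety A τ hτ1 hτ).IsLinearizable := by
  let R := MvPolynomial (Fin n) ℂ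
  let j : Spec (CommRingCat.of S) ⟶ (linVariety ρ).carrier :=
    Spec.map (CommRingCat.ofHom (algebraMap R S))
  let h : Spec (CommRingCat.of S) ⟶ (affineVariety A τ hτ1 hτ).carrier :=
    Spec.map (CommRingCat.ofHom A.val.toRingHom)
  have hj1 : IsOpenImmersion j := IsOpenImmersion.of_isLocalization P
  have hinj : Function.Injective (algebraMap R S) :=
    IsLocalization.injective S (M := Submonoid.powers P)
      (powers_le_nonZeroDivisors_of_noZeroDivisors hP)
  have hj2 : IsDominant j := isDominant_SpecMap_of_injective _ hinj
  have hh : IsDominant h := isDominant_SpecMap_of_injective _ Subtype.val_injective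
  refine ⟨n, ρ, (partialMapOfOpenImmersion j h).toRationalMap, ?_, ?_, ?_⟩
  · rw [Scheme.PartialMap.isDominant_toRationalMap_iff]
    change IsDominant (j.isoOpensRange.inv ≫ h)
    infer_instance
  · rw [← Scheme.RationalMap.compHom_toRationalMap, partialMapOfOpenImmersion_compHom]
    have : h ≫ (affineVariety A τ hτ1 hτ).str = j ≫ (linVariety ρ).str := by
      change Spec.map _ ≫ Spec.map _ = Spec.map _ ≫ Spec.map _
      rw [← Spec.map_comp, ← Spec.map_comp, ← CommRingCat.ofHom_comp, ← CommRingCat.ofHom_comp,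
        ← IsScalarTower.algebraMap_eq]
      rfl
    rw [this]
    exact Scheme.PartialMap.toRationalMap_eq_iff.mpr (partialMapOfOpenImmersion_self_equiv j _)
  · intro g
    let b : Spec (CommRingCat.of S) ⟶ Spec (CommRingCat.of S) :=
      Spec.map (CommRingCat.ofHom (σ g).toRingHom)
    have hb : b ≫ j = j ≫ ((linVariety ρ).act g).hom := by
      change Spec.map _ ≫ Spec.map _ = Spec.map _ ≫ Spec.map _
      rw [← Spec.map_comp, ← Spec.map_comp, ← CommRingCat.ofHom_comp, ← CommRingCat.ofHom_comp]
      congr 2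
      exact RingHom.ext (hσ g)
    have hbh : b ≫ h = h ≫ ((affineVariety A τ hτ1 hτ).act g).hom := by
      change Spec.map _ ≫ Spec.map _ = Spec.map _ ≫ Spec.map _
      rw [← Spec.map_comp, ← Spec.map_comp, ← CommRingCat.ofHom_comp, ← CommRingCat.ofHom_comp]
      congr 2
      exact RingHom.ext (hστ g)
    have hdom := (Scheme.PartialMap.isDominant_toRationalMap_iff _).mp
      ((linVariety ρ).isDominant_act g)
    rw [← Scheme.RationalMap.compHom_toRationalMap, partialMapOfOpenImmersion_compHom, ← hbh,
      Scheme.RationalMap.toRationalMap_comp]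
    exact Scheme.PartialMap.toRationalMap_eq_iff.mpr
      (toPartialMap_comp_partialMapOfOpenImmersion_equiv j h _ b hb)

end SubalgebraVariety

theorem ringKrullDim_le_of_isLocalization {R : Type*} (S : Type*) [CommRing R] [CommRing S]
    [Algebra R S] (M : Submonoid R) [IsLocalization M S] : ringKrullDim S ≤ ringKrullDim R :=
  Order.krullDim_le_of_strictMono (PrimeSpectrum.comap (algebraMap R S))
    (Monotone.strictMono_of_injective (fun _ _ h => Ideal.comap_mono h)
      (PrimeSpectrum.localization_comap_injective S M))

theorem essentialDim_le {G : Type*} [Group G] (X : GVariety G) (hX : X.IsFaithful)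
    (hX' : X.IsLinearizable) {d : ℕ} (h : topologicalKrullDim X.carrier ≤ d) :
    essentialDim G ≤ d := by
  have hne : Nonempty (TopologicalSpace.IrreducibleCloseds X.carrier) :=
    ⟨⟨Set.univ, IrreducibleSpace.isIrreducible_univ _, isClosed_univ⟩⟩
  have h0 : 0 ≤ topologicalKrullDim X.carrier := Order.krullDim_nonneg
  obtain ⟨e, he⟩ : ∃ e : ℕ, topologicalKrullDim X.carrier = e := by
    generalize topologicalKrullDim X.carrier = a at h h0
    induction a with
    | bot => simp at h0
    | coe a =>
      induction a with
      | top =>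
        have h' : ((⊤ : ℕ∞) : WithBot ℕ∞) ≤ ((d : ℕ∞) : WithBot ℕ∞) := h
        rw [WithBot.coe_le_coe, top_le_iff] at h'
        exact absurd h' (ENat.natCast_ne_top d)
      | coe a => exact ⟨a, rfl⟩
  have hmem : IsDimOfFaithfulLinearizable G e := ⟨X, hX, hX', he⟩
  rw [he] at h
  exact (Nat.sInf_le hmem).trans (by exact_mod_cast h)

theorem CqSemidirect.conj_inl {q : ℕ} (u : (ZMod q)ˣ) (x : ZMod q) :
    (SemidirectProduct.inr u * SemidirectProduct.inl (Multiplicative.ofAdd x) *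
      SemidirectProduct.inr u⁻¹ : CqSemidirect q) =
      SemidirectProduct.inl (Multiplicative.ofAdd ((u : ZMod q) * x)) := by
  rw [← SemidirectProduct.inl_aut, unitsAct_apply]

theorem Module.End.exists_hasEigenvalue_ne_one {V : Type*} [AddCommGroup V] [Module ℂ V]
    {f : Module.End ℂ V} {q : ℕ} (hq : q ≠ 0) (hf : f ^ q = 1) (hf1 : f ≠ 1) :
    ∃ ζ : ℂ, ζ ^ q = 1 ∧ ζ ≠ 1 ∧ f.HasEigenvalue ζ := by
  by_contra! h
  apply hf1
  have hprim := Complex.isPrimitiveRoot_exp q hq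
  have h1 := congrArg (Polynomial.aeval f)
    (Polynomial.X_pow_sub_one_eq_prod (Nat.pos_of_ne_zero hq) hprim)
  have hmem : (1 : ℂ) ∈ Polynomial.nthRootsFinset q (1 : ℂ) := by
    rw [Polynomial.mem_nthRootsFinset (Nat.pos_of_ne_zero hq), one_pow]
  rw [← Finset.prod_erase_mul _ _ hmem, map_mul] at h1
  simp only [map_sub, map_pow, map_one, Polynomial.aeval_X, hf, sub_self] at h1
  have hinj : Function.Injective (Polynomial.aeval f
      (∏ ζ ∈ (Polynomial.nthRootsFinset q (1 : ℂ)).erase 1,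
        (Polynomial.X - Polynomial.C ζ))) := by
    refine Finset.prod_induction _ (fun p => Function.Injective (Polynomial.aeval f p))
      (fun a b ha hb => ?_) ?_ fun ζ hζ => ?_
    · rw [map_mul]
      exact ha.comp hb
    · rw [map_one]
      exact Function.injective_id
    · rw [Finset.mem_erase, Polynomial.mem_nthRootsFinset (Nat.pos_of_ne_zero hq)] at hζ
      have := h ζ hζ.2 hζ.1
      rw [Module.End.hasEigenvalue_iff, not_not, Module.End.eigenspace_def,
        LinearMap.ker_eq_bot] at this
      rwa [map_sub, Polynomial.aeval_X, Polynomial.aeval_C, Algebra.algebraMap_eq_smul_one]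
  ext v
  have h2 := LinearMap.congr_fun h1 v
  rw [Module.End.mul_apply, LinearMap.zero_apply] at h2
  have h3 := hinj (h2.symm.trans (map_zero _).symm)
  simpa [sub_eq_zero] using h3

theorem le_of_injective_CqSemidirect {q r : ℕ} (hq : q.Prime)
    (ρ : CqSemidirect q →* Matrix.GeneralLinearGroup (Fin r) ℂ) (hρ : Function.Injective ρ) :
    q - 1 ≤ r := by
  have : Fact q.Prime := ⟨hq⟩
  let τ : CqSemidirect q →* Module.End ℂ (Fin r → ℂ) :=
    (Matrix.toLinAlgEquiv' (R := ℂ) (n := Fin r)).toMulEquiv.toMonoidHom.comp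
      ((Units.coeHom _).comp ρ)
  have hτ : Function.Injective τ :=
    (Matrix.toLinAlgEquiv' (R := ℂ) (n := Fin r)).injective.comp (Units.val_injective.comp hρ)
  let c : ZMod q → CqSemidirect q := fun x => SemidirectProduct.inl (Multiplicative.ofAdd x)
  have hc : ∀ x : ZMod q, c x = c 1 ^ x.val := by
    intro x
    simp only [c]
    rw [← map_pow, ← ofAdd_nsmul, nsmul_eq_mul, mul_one, ZMod.natCast_zmod_val]
  obtain ⟨ζ, hζ, hζ1, hev⟩ : ∃ ζ : ℂ, ζ ^ q = 1 ∧ ζ ≠ 1 ∧ (τ (c 1)).HasEigenvalue ζ := by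
    apply Module.End.exists_hasEigenvalue_ne_one hq.ne_zero
    · rw [← map_pow]
      have : c 1 ^ q = 1 := by
        simp only [c]
        rw [← map_pow, ← ofAdd_nsmul, nsmul_eq_mul, mul_one, ZMod.natCast_self]; rfl
      rw [this, map_one]
    · intro h
      rw [← map_one τ] at h
      have := SemidirectProduct.inl_injective (hτ h)
      exact one_ne_zero (Multiplicative.ofAdd.injective this)
  obtain ⟨w, hw⟩ := hev.exists_hasEigenvector
  have hprim : IsPrimitiveRoot ζ q := by
    rw [← orderOf_eq_prime hζ hζ1]
    exact IsPrimitiveRoot.orderOf ζ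
  have key : ∀ u : (ZMod q)ˣ, (τ (c 1)).HasEigenvector (ζ ^ (u : ZMod q).val)
      (τ (SemidirectProduct.inr u⁻¹) w) := by
    intro u
    have hinv : τ (SemidirectProduct.inr u) (τ (SemidirectProduct.inr u⁻¹) w) = w := by
      rw [← Module.End.mul_apply, ← map_mul, ← map_mul, mul_inv_cancel, map_one, map_one]; rfl
    refine Module.End.hasEigenvector_iff.mpr ⟨Module.End.mem_eigenspace_iff.mpr ?_, ?_⟩
    · have h1 : c 1 * SemidirectProduct.inr u⁻¹ =
          SemidirectProduct.inr u⁻¹ * c 1 ^ (u : ZMod q).val := by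
        rw [← hc]
        have := CqSemidirect.conj_inl u (1 : ZMod q)
        rw [mul_one] at this
        simp only [c]
        rw [← this, map_inv]
        group
      rw [← Module.End.mul_apply, ← map_mul, h1, map_mul, Module.End.mul_apply, map_pow,
        hw.pow_apply, map_smul]
    · intro h0
      rw [h0, map_zero] at hinv
      exact hw.2 hinv.symm
  have hli := Module.End.eigenvectors_linearIndependent' (τ (c 1))
    (fun u : (ZMod q)ˣ => ζ ^ (u : ZMod q).val) (fun u v huv => by
      have := hprim.pow_inj (ZMod.val_lt _) (ZMod.val_lt _) huv
      exact Units.ext (ZMod.val_injective q this)) _ key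
  have := hli.fintype_card_le_finrank
  rwa [ZMod.card_units_eq_totient, Nat.totient_prime hq, Module.finrank_fin_fun] at this

theorem totient_div_le_prod {n r : ℕ} (hn : n ≠ 0)
    (h : ∏ i ∈ Finset.range r, Nat.nth Nat.Prime i ∣ n) :
    (n.totient : ℝ) / n ≤ ∏ i ∈ Finset.range r, (1 - (Nat.nth Nat.Prime i : ℝ)⁻¹) := by
  have h1 : (n.totient : ℝ) = n * ∏ p ∈ n.primeFactors, (1 - (p : ℝ)⁻¹) := by
    have := congrArg (Rat.cast : ℚ → ℝ) (Nat.totient_eq_mul_prod_factors n)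
    push_cast at this
    exact this
  have hn' : (n : ℝ) ≠ 0 := Nat.cast_ne_zero.mpr hn
  have hinj : Function.Injective (Nat.nth Nat.Prime) :=
    Nat.nth_injective Nat.infinite_setOfPred_prime
  rw [h1, mul_div_cancel_left₀ _ hn',
    ← Finset.prod_image (f := fun p : ℕ => (1 - (p : ℝ)⁻¹)) (s := Finset.range r)
      (g := Nat.nth Nat.Prime) hinj.injOn]
  have hle : ∀ p ∈ n.primeFactors, (p : ℝ)⁻¹ ≤ 1 := fun p hp =>
    inv_le_one_of_one_le₀ (by exact_mod_cast (Nat.prime_of_mem_primeFactors hp).one_le)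
  refine Finset.prod_le_prod_of_subset_of_le_one ?_ (fun p hp => sub_nonneg.mpr (hle p hp))
    fun p _ _ => sub_le_self _ (by positivity)
  intro p hp
  obtain ⟨i, hi, rfl⟩ := Finset.mem_image.mp hp
  exact Nat.mem_primeFactors.mpr
    ⟨Nat.prime_nth_prime i, (Finset.dvd_prod_of_mem _ hi).trans h, hn⟩

theorem tendsto_prod_one_sub_inv_prime :
    Filter.Tendsto (fun r => ∏ i ∈ Finset.range r, (1 - (Nat.nth Nat.Prime i : ℝ)⁻¹))
      Filter.atTop (nhds 0) := by
  have hns : ¬ Summable (fun i => ((Nat.nth Nat.Prime i : ℝ)⁻¹)) := by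
    intro h
    apply Nat.Primes.not_summable_one_div
    let e : Nat.Primes → ℕ := fun p => Nat.count Nat.Prime p
    have := h.comp_injective (i := e) (fun p p' hpp => by
      exact Subtype.ext (Nat.count_injective p.2 p'.2 hpp))
    refine this.congr fun p => ?_
    simp only [e, Function.comp, Nat.nth_count p.2, one_div]
  have h1 := (not_summable_iff_tendsto_nat_atTop_of_nonneg (fun i => by positivity)).mp hns
  refine squeeze_zero (fun r => Finset.prod_nonneg fun i _ => ?_) (fun r => ?_)
    (Real.tendsto_exp_neg_atTop_nhds_zero.comp h1)
  · have : (1 : ℝ) ≤ Nat.nth Nat.Prime i := by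
      exact_mod_cast (Nat.prime_nth_prime i).one_le
    exact sub_nonneg.mpr (inv_le_one_of_one_le₀ this)
  · simp only [Function.comp]
    rw [← Finset.sum_neg_distrib, Real.exp_sum]
    refine Finset.prod_le_prod (fun i _ => ?_) fun i _ => ?_
    · have : (1 : ℝ) ≤ Nat.nth Nat.Prime i := by
        exact_mod_cast (Nat.prime_nth_prime i).one_le
      exact sub_nonneg.mpr (inv_le_one_of_one_le₀ this)
    · exact Real.one_sub_le_exp_neg _

theorem CqSemidirect.injective_of_inl {q : ℕ} {M : Type*} [Monoid M] (f : CqSemidirect q →* M)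
    (h : ∀ z : ZMod q, f (SemidirectProduct.inl (Multiplicative.ofAdd z)) = 1 → z = 0) :
    Function.Injective f := by
  rw [injective_iff_map_eq_one]
  intro g hg
  have hg' : f g⁻¹ = 1 := by
    rw [← one_mul (f g⁻¹), ← hg, ← map_mul, mul_inv_cancel, map_one, hg]
  obtain ⟨x, u⟩ := g
  let c : CqSemidirect q := SemidirectProduct.inl (Multiplicative.ofAdd 1)
  have hcomm : (⟨x, u⟩ * c * ⟨x, u⟩⁻¹ * c⁻¹ : CqSemidirect q) =
      SemidirectProduct.inl (Multiplicative.ofAdd ((u : ZMod q) - 1)) := by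
    have hx : (⟨x, u⟩ : CqSemidirect q) = SemidirectProduct.inl x * SemidirectProduct.inr u :=
      SemidirectProduct.mk_eq_inl_mul_inr u x
    have hc := CqSemidirect.conj_inl u (1 : ZMod q)
    rw [mul_one, map_inv] at hc
    rw [hx, mul_inv_rev]
    calc _ = SemidirectProduct.inl x *
          (SemidirectProduct.inr u * c * (SemidirectProduct.inr u)⁻¹) *
          (SemidirectProduct.inl x)⁻¹ * c⁻¹ := by group
      _ = SemidirectProduct.inl (x * Multiplicative.ofAdd (u : ZMod q) * x⁻¹ *
          (Multiplicative.ofAdd 1)⁻¹) := by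
        rw [hc]; simp only [map_mul, map_inv, c]
      _ = _ := by
        rw [mul_comm x, mul_inv_cancel_right, ← div_eq_mul_inv, ← ofAdd_sub]
  have hu : u = 1 := by
    have h1 : f (⟨x, u⟩ * c * ⟨x, u⟩⁻¹ * c⁻¹) = 1 := by
      rw [map_mul, map_mul, map_mul, hg, hg', one_mul, mul_one, ← map_mul, mul_inv_cancel, map_one]
    rw [hcomm] at h1
    exact Units.ext (sub_eq_zero.mp (h _ h1))
  subst hu
  have : x = 1 := h x.toAdd hg
  rw [this]
  rfl

section MonomialRep

variable {q : ℕ} [Fact q.Prime] {N : ℕ} (e : Fin N ≃ (ZMod q)ˣ)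

/-- The representation of `C_q ⋊ C_q^*` induced from a faithful character of `C_q`: on functions on
`C_q^*` it is `((x, u) f)(v) = exp(2πi x v / q) f(v u)`. -/
noncomputable def monomialRep : CqSemidirect q →* Matrix.GeneralLinearGroup (Fin N) ℂ :=
  MonoidHom.toHomUnits
    { toFun g := Matrix.of fun i j =>
        if j = e.symm (e i * g.right) then ZMod.stdAddChar (g.left.toAdd * (e i : ZMod q)) else 0
      map_one' := by
        ext i j
        simp [Matrix.one_apply, eq_comm]
      map_mul' g h := by
        ext i j
        simp only [Matrix.mul_apply, Matrix.of_apply, ite_mul, zero_mul, Finset.sum_ite_eq',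
          Finset.mem_univ, if_true, Equiv.apply_symm_apply, SemidirectProduct.mul_right, mul_assoc]
        split_ifs
        · rw [← AddChar.map_add_eq_mul]
          congr 1
          change (g.left.toAdd + (g.right : ZMod q) * h.left.toAdd) * _ = _
          rw [Units.val_mul]
          ring
        · simp }

theorem monomialRep_apply (g : CqSemidirect q) (i j : Fin N) :
    (monomialRep e g).val i j =
      if j = e.symm (e i * g.right) then ZMod.stdAddChar (g.left.toAdd * (e i : ZMod q)) else 0 :=
  rfl

theorem monomialRep_injective : Function.Injective (monomialRep e) := by
  apply CqSemidirect.injective_of_inl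
  intro z hz
  let i := e.symm 1
  have h1 : (monomialRep e (SemidirectProduct.inl (Multiplicative.ofAdd z))).val i i = 1 := by
    rw [hz, Units.val_one, Matrix.one_apply_eq]
  rw [monomialRep_apply] at h1
  simp only [i, SemidirectProduct.right_inl, mul_one, if_true,
    SemidirectProduct.left_inl, Equiv.apply_symm_apply, Units.val_one, toAdd_ofAdd] at h1
  exact ZMod.injective_stdAddChar (h1.trans (AddChar.map_zero_eq_one _).symm)

theorem linPullback_monomialRep_X (g : CqSemidirect q) (i : Fin N) :
    linPullback (monomialRep e g).val (MvPolynomial.X i) =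
      (ZMod.stdAddChar (g.left.toAdd * (e i : ZMod q)) : ℂ) •
        MvPolynomial.X (e.symm (e i * g.right)) := by
  simp only [linPullback, MvPolynomial.aeval_X, monomialRep_apply]
  rw [Finset.sum_eq_single (e.symm (e i * g.right)) (fun j _ hj => by simp [hj]) (by simp),
    if_pos rfl, MvPolynomial.smul_eq_C_mul]

end MonomialRep

theorem representationDim_CqSemidirect {q : ℕ} (hq : q.Prime) :
    representationDim (CqSemidirect q) = q - 1 := by
  have : Fact q.Prime := ⟨hq⟩
  have e : Fin (q - 1) ≃ (ZMod q)ˣ :=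
    (Fintype.equivFinOfCardEq (by rw [ZMod.card_units_eq_totient, Nat.totient_prime hq])).symm
  have hmem : q - 1 ∈ {r | 0 < r ∧ ∃ ρ : CqSemidirect q →* Matrix.GeneralLinearGroup (Fin r) ℂ,
      Function.Injective ρ} :=
    ⟨Nat.sub_pos_of_lt hq.one_lt, monomialRep e, monomialRep_injective e⟩
  refine le_antisymm (Nat.sInf_le hmem) (le_csInf ⟨_, hmem⟩ ?_)
  rintro r ⟨-, ρ, hρ⟩
  exact le_of_injective_CqSemidirect hq ρ hρ

theorem Polynomial.int_induction {p : Polynomial ℤ → Prop} (hX : ∀ i, p (Polynomial.X ^ i))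
    (hadd : ∀ f g, p f → p g → p (f + g)) (hneg : ∀ f, p f → p (-f)) (f : Polynomial ℤ) : p f := by
  have h0 : p 0 := by
    have := hadd _ _ (hX 0) (hneg _ (hX 0))
    rwa [add_neg_cancel] at this
  induction f using Polynomial.induction_on' with
  | add f g hf hg => exact hadd f g hf hg
  | monomial i a =>
    rw [← Polynomial.C_mul_X_pow_eq_monomial]
    induction a using Int.induction_on with
    | zero => simpa using h0
    | succ k hk =>
      rw [map_add, add_mul, map_one, one_mul]
      exact hadd _ _ hk (hX i)
    | pred k hk =>
      rw [map_sub, sub_mul, map_one, one_mul, sub_eq_add_neg]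
      exact hadd _ _ hk (hneg _ (hX i))

/-- The coordinate ring of the torus in `ℂᴺ` where all coordinates are nonzero. -/
abbrev TorusRing (N : ℕ) : Type :=
  Localization.Away (∏ i, MvPolynomial.X i : MvPolynomial (Fin N) ℂ)

theorem prod_X_ne_zero (N : ℕ) : (∏ i, MvPolynomial.X i : MvPolynomial (Fin N) ℂ) ≠ 0 :=
  Finset.prod_ne_zero_iff.mpr fun i _ => MvPolynomial.X_ne_zero i

instance TorusRing.isDomain (N : ℕ) : IsDomain (TorusRing N) :=
  IsLocalization.isDomain_localization
    (powers_le_nonZeroDivisors_of_noZeroDivisors (prod_X_ne_zero N))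

theorem TorusRing.isUnit_X {N : ℕ} (i : Fin N) :
    IsUnit (algebraMap (MvPolynomial (Fin N) ℂ) (TorusRing N) (MvPolynomial.X i)) :=
  isUnit_of_dvd_unit (map_dvd _ (Finset.dvd_prod_of_mem _ (Finset.mem_univ i)))
    (IsLocalization.Away.algebraMap_isUnit _)

/-- The coordinates as units of the coordinate ring of the torus. -/
noncomputable def TorusRing.coord {N : ℕ} (i : Fin N) : (TorusRing N)ˣ :=
  (TorusRing.isUnit_X i).unit

theorem TorusRing.coe_coord {N : ℕ} (i : Fin N) :
    (TorusRing.coord i : TorusRing N) =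
      algebraMap (MvPolynomial (Fin N) ℂ) (TorusRing N) (MvPolynomial.X i) :=
  rfl

section TorusAct

variable {q : ℕ} [Fact q.Prime] {N : ℕ} (e : Fin N ≃ (ZMod q)ˣ)

theorem isUnit_algebraMap_linPullback_prod_X (g : CqSemidirect q) :
    IsUnit (((IsScalarTower.toAlgHom ℂ (MvPolynomial (Fin N) ℂ) (TorusRing N)).comp
      (linPullback (monomialRep e g).val)) (∏ i, MvPolynomial.X i)) := by
  rw [map_prod, IsUnit.prod_univ_iff]
  intro i
  rw [AlgHom.comp_apply, linPullback_monomialRep_X, map_smul, Algebra.smul_def]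
  exact ((AddChar.val_isUnit _ _).map _).mul (TorusRing.isUnit_X _)

/-- The action of `C_q ⋊ C_q^*` on the coordinate ring of the torus through `monomialRep`. -/
noncomputable def torusAct (g : CqSemidirect q) : TorusRing N →ₐ[ℂ] TorusRing N :=
  IsLocalization.Away.liftAlgHom (∏ i, MvPolynomial.X i : MvPolynomial (Fin N) ℂ)
    (isUnit_algebraMap_linPullback_prod_X e g)

theorem torusAct_algebraMap (g : CqSemidirect q) (p : MvPolynomial (Fin N) ℂ) :
    torusAct e g (algebraMap _ _ p) = algebraMap _ _ (linPullback (monomialRep e g).val p) :=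
  IsLocalization.Away.lift_eq _ (isUnit_algebraMap_linPullback_prod_X e g) p

theorem torusAct_ext {f g : TorusRing N →ₐ[ℂ] TorusRing N}
    (h : ∀ p : MvPolynomial (Fin N) ℂ, f (algebraMap _ _ p) = g (algebraMap _ _ p)) : f = g :=
  AlgHom.coe_ringHom_injective <| IsLocalization.ringHom_ext
    (Submonoid.powers (∏ i, MvPolynomial.X i : MvPolynomial (Fin N) ℂ)) (RingHom.ext h)

theorem torusAct_one : torusAct e 1 = AlgHom.id ℂ _ := by
  refine torusAct_ext fun p => ?_
  rw [torusAct_algebraMap, map_one, Units.val_one, linPullback_one]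
  rfl

theorem torusAct_mul (g h : CqSemidirect q) :
    torusAct e (g * h) = (torusAct e h).comp (torusAct e g) := by
  refine torusAct_ext fun p => ?_
  rw [AlgHom.comp_apply, torusAct_algebraMap, torusAct_algebraMap, torusAct_algebraMap, map_mul,
    Units.val_mul, linPullback_mul]
  rfl

theorem torusAct_coord (g : CqSemidirect q) (v : (ZMod q)ˣ) :
    torusAct e g (TorusRing.coord (e.symm v)) =
      (ZMod.stdAddChar (g.left.toAdd * (v : ZMod q)) : ℂ) •
        (TorusRing.coord (e.symm (v * g.right)) : TorusRing N) := by
  rw [TorusRing.coe_coord, torusAct_algebraMap, linPullback_monomialRep_X, Equiv.apply_symm_apply,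
    TorusRing.coe_coord]
  exact map_smul (IsScalarTower.toAlgHom ℂ (MvPolynomial (Fin N) ℂ) (TorusRing N)) _ _

/-- The character of the torus with exponents the coefficients of an integral polynomial `p`, the
coefficient of `Xⁱ` being the exponent of the coordinate indexed by `ξⁱ`. -/
noncomputable def torusChar (ξ : (ZMod q)ˣ) (p : Polynomial ℤ) : (TorusRing N)ˣ :=
  (Polynomial.lsum (fun i => LinearMap.toSpanSingleton ℤ (Additive (TorusRing N)ˣ)
    (Additive.ofMul (TorusRing.coord (e.symm (ξ ^ i))))) p).toMul

variable (ξ : (ZMod q)ˣ)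

theorem torusChar_add (p r : Polynomial ℤ) :
    torusChar e ξ (p + r) = torusChar e ξ p * torusChar e ξ r := by
  simp only [torusChar, map_add, toMul_add]

theorem torusChar_neg (p : Polynomial ℤ) : torusChar e ξ (-p) = (torusChar e ξ p)⁻¹ := by
  simp only [torusChar, map_neg, toMul_neg]

theorem torusChar_X_pow (i : ℕ) :
    torusChar e ξ (Polynomial.X ^ i) = TorusRing.coord (e.symm (ξ ^ i)) := by
  simp only [torusChar, Polynomial.lsum_apply, Polynomial.X_pow_eq_monomial]
  rw [Polynomial.sum_monomial_index _ _ (by simp)]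
  simp

theorem torusChar_zero : torusChar e ξ 0 = 1 := by
  simp only [torusChar, map_zero, toMul_zero]

theorem torusChar_X_pow_sub_one_mul (p : Polynomial ℤ) :
    torusChar e ξ ((Polynomial.X ^ orderOf ξ - 1) * p) = 1 := by
  induction p using Polynomial.int_induction with
  | hX i =>
    rw [sub_mul, one_mul, ← pow_add, sub_eq_add_neg, torusChar_add, torusChar_neg, torusChar_X_pow,
      torusChar_X_pow, pow_add, pow_orderOf_eq_one, one_mul, mul_inv_cancel]
  | hadd f g hf hg => rw [mul_add, torusChar_add, hf, hg, one_mul]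
  | hneg f hf => rw [mul_neg, torusChar_neg, hf, inv_one]

theorem torusAct_torusChar (x : ZMod q) (k : ℕ) (p : Polynomial ℤ) :
    torusAct e ⟨Multiplicative.ofAdd x, ξ ^ k⟩ (torusChar e ξ p) =
      (ZMod.stdAddChar (x * Polynomial.aeval (ξ : ZMod q) p) : ℂ) •
        (torusChar e ξ (Polynomial.X ^ k * p) : TorusRing N) := by
  induction p using Polynomial.int_induction with
  | hX i =>
    rw [torusChar_X_pow, torusAct_coord, ← pow_add ξ, ← pow_add Polynomial.X, torusChar_X_pow,
      add_comm i k]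
    simp
  | hadd f g hf hg =>
    rw [torusChar_add, Units.val_mul, map_mul, hf, hg, mul_add, torusChar_add, Units.val_mul,
      map_add, mul_add, AddChar.map_add_eq_mul, smul_mul_smul_comm]
  | hneg f hf =>
    refine left_inv_eq_right_inv (a := torusAct e ⟨Multiplicative.ofAdd x, ξ ^ k⟩
      (torusChar e ξ f)) ?_ ?_
    · rw [← map_mul, torusChar_neg, Units.inv_mul, map_one]
    · rw [hf, smul_mul_smul_comm, ← AddChar.map_add_eq_mul, mul_neg, torusChar_neg, Units.mul_inv,
        map_neg, mul_neg, add_neg_cancel, AddChar.map_zero_eq_one, one_smul]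

end TorusAct

theorem aeval_prod_properDivisors_cyclotomic_ne_zero {K : Type*} [Field K] {ξ : K} {n : ℕ}
    (hξ : IsPrimitiveRoot ξ n) :
    Polynomial.aeval ξ (∏ i ∈ n.properDivisors, Polynomial.cyclotomic i ℤ) ≠ 0 := by
  rw [map_prod, Finset.prod_ne_zero_iff]
  intro i hi h0
  rw [Nat.mem_properDivisors] at hi
  have hi0 : 0 < i := Nat.pos_of_ne_zero fun h => by
    subst h
    rw [zero_dvd_iff.mp hi.1] at hi
    exact lt_irrefl _ hi.2
  have hdvd : Polynomial.cyclotomic i ℤ ∣ Polynomial.X ^ i - 1 :=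
    Polynomial.cyclotomic.dvd_X_pow_sub_one i ℤ
  have h1 := map_dvd (Polynomial.aeval ξ) hdvd
  rw [h0, zero_dvd_iff] at h1
  simp only [map_sub, map_pow, Polynomial.aeval_X, map_one, sub_eq_zero] at h1
  exact absurd (Nat.le_of_dvd hi0 (hξ.dvd_of_pow_eq_one i h1)) (not_le.mpr hi.2)

theorem cyclotomic_mul_prod_properDivisors {n : ℕ} (hn : 0 < n) :
    Polynomial.cyclotomic n ℤ * ∏ i ∈ n.properDivisors, Polynomial.cyclotomic i ℤ =
      Polynomial.X ^ n - 1 := by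
  rw [← Polynomial.prod_cyclotomic_eq_X_pow_sub_one hn, ← Nat.cons_self_properDivisors hn.ne',
    Finset.prod_cons]

section QuotientTorus

variable {q : ℕ} [Fact q.Prime] {N : ℕ} (e : Fin N ≃ (ZMod q)ˣ) (ξ : (ZMod q)ˣ) (Ψ : Polynomial ℤ)

/-- The coordinate ring of the quotient of the torus whose characters are the multiples of `Ψ`. -/
noncomputable def quotientTorusRing : Subalgebra ℂ (TorusRing N) :=
  Algebra.adjoin ℂ (Set.range fun p : Polynomial ℤ => (torusChar e ξ (Ψ * p) : TorusRing N))

theorem torusChar_mem (p : Polynomial ℤ) :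
    (torusChar e ξ (Ψ * p) : TorusRing N) ∈ quotientTorusRing e ξ Ψ :=
  Algebra.subset_adjoin ⟨p, rfl⟩

theorem torusAct_mem (hξ : ∀ u, u ∈ Submonoid.powers ξ) (g : CqSemidirect q)
    (a : quotientTorusRing e ξ Ψ) : torusAct e g a ∈ quotientTorusRing e ξ Ψ := by
  suffices h : quotientTorusRing e ξ Ψ ≤ (quotientTorusRing e ξ Ψ).comap (torusAct e g) from h a.2
  refine Algebra.adjoin_le ?_
  rintro _ ⟨p, rfl⟩
  obtain ⟨x, u⟩ := g
  obtain ⟨k, rfl⟩ := hξ u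
  have := torusAct_torusChar e ξ x.toAdd k (Ψ * p)
  rw [ofAdd_toAdd] at this
  change torusAct e ⟨x, ξ ^ k⟩ _ ∈ quotientTorusRing e ξ Ψ
  rw [this, mul_left_comm]
  exact Subalgebra.smul_mem _ (torusChar_mem e ξ Ψ _) _

/-- The action of `C_q ⋊ C_q^*` on the coordinate ring of the quotient torus. -/
noncomputable def quotientTorusAct (hξ : ∀ u, u ∈ Submonoid.powers ξ) (g : CqSemidirect q) :
    quotientTorusRing e ξ Ψ →ₐ[ℂ] quotientTorusRing e ξ Ψ :=
  ((torusAct e g).comp (quotientTorusRing e ξ Ψ).val).codRestrict _ (torusAct_mem e ξ Ψ hξ g)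

/-- The characters of the quotient torus as units of its coordinate ring. -/
noncomputable def quotientTorusChar (p : Polynomial ℤ) : (quotientTorusRing e ξ Ψ)ˣ where
  val := ⟨torusChar e ξ (Ψ * p), torusChar_mem e ξ Ψ p⟩
  inv := ⟨torusChar e ξ (Ψ * -p), torusChar_mem e ξ Ψ (-p)⟩
  val_inv := by
    apply Subtype.ext
    simp [mul_neg, torusChar_neg]
  inv_val := by
    apply Subtype.ext
    simp [mul_neg, torusChar_neg]

theorem isUnit_aeval_quotientTorusChar_prod_X (d : ℕ) :
    IsUnit (MvPolynomial.aeval (R := ℂ) (fun i : Fin d =>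
      (quotientTorusChar e ξ Ψ (Polynomial.X ^ (i : ℕ)) : quotientTorusRing e ξ Ψ))
      (∏ i, MvPolynomial.X i)) := by
  rw [map_prod, IsUnit.prod_univ_iff]
  intro i
  rw [MvPolynomial.aeval_X]
  exact Units.isUnit _

/-- The map from the Laurent polynomials in `d` variables to the coordinate ring of the quotient
torus that takes the `i`-th variable to the character `Ψ Xⁱ`. -/
noncomputable def laurentToQuotientTorusRing (d : ℕ) :
    TorusRing d →ₐ[ℂ] quotientTorusRing e ξ Ψ :=
  IsLocalization.Away.liftAlgHom (∏ i, MvPolynomial.X i : MvPolynomial (Fin d) ℂ)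
    (isUnit_aeval_quotientTorusChar_prod_X e ξ Ψ d)

theorem laurentToQuotientTorusRing_coord {d : ℕ} (i : Fin d) :
    Units.map (laurentToQuotientTorusRing e ξ Ψ d : TorusRing d →* quotientTorusRing e ξ Ψ)
      (TorusRing.coord i) = quotientTorusChar e ξ Ψ (Polynomial.X ^ (i : ℕ)) := by
  apply Units.ext
  have h := IsLocalization.Away.lift_eq (S := TorusRing d) _
    (isUnit_aeval_quotientTorusChar_prod_X e ξ Ψ d) (MvPolynomial.X i)
  exact h.trans (MvPolynomial.aeval_X _ _)

theorem laurentToQuotientTorusRing_surjective {Φ : Polynomial ℤ} (hΦ : Φ.Monic)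
    (hΦΨ : Φ * Ψ = Polynomial.X ^ orderOf ξ - 1) :
    Function.Surjective (laurentToQuotientTorusRing e ξ Ψ Φ.natDegree) := by
  set F := laurentToQuotientTorusRing e ξ Ψ Φ.natDegree
  let H : AddSubgroup (Polynomial ℤ) :=
    { carrier := {p | quotientTorusChar e ξ Ψ p ∈
        (Units.map (F : TorusRing Φ.natDegree →* quotientTorusRing e ξ Ψ)).range}
      add_mem' := by
        intro a b ha hb
        have : quotientTorusChar e ξ Ψ (a + b) =
            quotientTorusChar e ξ Ψ a * quotientTorusChar e ξ Ψ b := by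
          apply Units.ext
          apply Subtype.ext
          simp [quotientTorusChar, mul_add, torusChar_add]
        simpa only [Set.mem_ofPred_eq, this] using mul_mem ha hb
      zero_mem' := by
        have : quotientTorusChar e ξ Ψ 0 = 1 := by
          apply Units.ext
          apply Subtype.ext
          simp [quotientTorusChar, torusChar_zero]
        simpa only [Set.mem_ofPred_eq, this] using one_mem _
      neg_mem' := by
        intro a ha
        have : quotientTorusChar e ξ Ψ (-a) = (quotientTorusChar e ξ Ψ a)⁻¹ := by
          apply Units.ext
          rfl
        simpa only [Set.mem_ofPred_eq, this] using inv_mem ha }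
  have hH : ∀ p, p ∈ H := by
    intro p
    rw [← Polynomial.modByMonic_add_div p Φ]
    refine H.add_mem ?_ ?_
    · rcases eq_or_ne Φ 1 with rfl | h1
      · rw [Polynomial.modByMonic_one]
        exact H.zero_mem
      rw [Polynomial.as_sum_range' (p %ₘ Φ) Φ.natDegree (Polynomial.natDegree_modByMonic_lt p hΦ h1)]
      refine H.sum_mem fun i hi => ?_
      rw [← mul_one ((p %ₘ Φ).coeff i), ← smul_eq_mul, ← Polynomial.smul_monomial,
        ← Polynomial.X_pow_eq_monomial]
      refine H.zsmul_mem ?_ _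
      exact ⟨_, laurentToQuotientTorusRing_coord e ξ Ψ ⟨i, Finset.mem_range.mp hi⟩⟩
    · have : quotientTorusChar e ξ Ψ (Φ * (p /ₘ Φ)) = 1 := by
        apply Units.ext
        apply Subtype.ext
        change (torusChar e ξ (Ψ * (Φ * (p /ₘ Φ))) : TorusRing N) = 1
        rw [← mul_assoc, mul_comm Ψ, hΦΨ, torusChar_X_pow_sub_one_mul, Units.val_one]
      change quotientTorusChar e ξ Ψ (Φ * (p /ₘ Φ)) ∈
        (Units.map (F : TorusRing Φ.natDegree →* quotientTorusRing e ξ Ψ)).range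
      rw [this]
      exact one_mem _
  have hle : quotientTorusRing e ξ Ψ ≤ ((quotientTorusRing e ξ Ψ).val.comp F).range := by
    refine Algebra.adjoin_le ?_
    rintro _ ⟨p, rfl⟩
    obtain ⟨y, hy⟩ := hH p
    exact ⟨y, congrArg (fun u : (quotientTorusRing e ξ Ψ)ˣ => (u.val : TorusRing N)) hy⟩
  intro a
  obtain ⟨y, hy⟩ := hle a.2
  exact ⟨y, Subtype.ext hy⟩

end QuotientTorus

theorem essentialDim_CqSemidirect_le {q : ℕ} (hq : q.Prime) :
    essentialDim (CqSemidirect q) ≤ Nat.totient (q - 1) := by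
  have : Fact q.Prime := ⟨hq⟩
  have hcard : Fintype.card (ZMod q)ˣ = q - 1 := by
    rw [ZMod.card_units_eq_totient, Nat.totient_prime hq]
  have e : Fin (q - 1) ≃ (ZMod q)ˣ := (Fintype.equivFinOfCardEq hcard).symm
  obtain ⟨ξ, hξ⟩ := IsCyclic.exists_monoid_generator (α := (ZMod q)ˣ)
  have hord : orderOf ξ = q - 1 := by
    rw [orderOf_eq_card_of_forall_mem_powers hξ, Nat.card_eq_fintype_card, hcard]
  have hpos : 0 < q - 1 := Nat.sub_pos_of_lt hq.one_lt
  let Ψ : Polynomial ℤ := ∏ i ∈ (q - 1).properDivisors, Polynomial.cyclotomic i ℤ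
  have hΨ : Polynomial.aeval (ξ : ZMod q) Ψ ≠ 0 := by
    apply aeval_prod_properDivisors_cyclotomic_ne_zero
    rw [IsPrimitiveRoot.coe_units_iff, ← hord]
    exact IsPrimitiveRoot.orderOf ξ
  have hsurj := laurentToQuotientTorusRing_surjective e ξ Ψ
    (Polynomial.cyclotomic.monic (q - 1) ℤ)
    (by rw [hord]; exact cyclotomic_mul_prod_properDivisors hpos)
  rw [Polynomial.natDegree_cyclotomic] at hsurj
  have hft : Algebra.FiniteType ℂ (quotientTorusRing e ξ Ψ) := by
    have : Algebra.FinitePresentation (MvPolynomial (Fin (q - 1).totient) ℂ)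
        (TorusRing (q - 1).totient) :=
      IsLocalization.Away.finitePresentation (∏ i, MvPolynomial.X i)
    have : Algebra.FiniteType ℂ (TorusRing (q - 1).totient) :=
      Algebra.FiniteType.trans (S := MvPolynomial (Fin (q - 1).totient) ℂ) inferInstance
        inferInstance
    exact Algebra.FiniteType.of_surjective _ hsurj
  let τ := quotientTorusAct e ξ Ψ hξ
  have hτ1 : τ 1 = AlgHom.id ℂ _ :=
    AlgHom.ext fun a => Subtype.ext (DFunLike.congr_fun (torusAct_one e) (a : TorusRing (q - 1)))
  have hτ : ∀ g h, τ (g * h) = (τ h).comp (τ g) := fun g h =>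
    AlgHom.ext fun a =>
      Subtype.ext (DFunLike.congr_fun (torusAct_mul e g h) (a : TorusRing (q - 1)))
  refine essentialDim_le (affineVariety _ τ hτ1 hτ) ?_
    (affineVariety_isLinearizable (monomialRep e) _ τ hτ1 hτ (∏ i, MvPolynomial.X i)
      (prod_X_ne_zero _) (torusAct e) (torusAct_algebraMap e) fun _ _ => rfl) ?_
  · refine CqSemidirect.injective_of_inl _ fun z hz => ?_
    rw [← map_one (affineVariety _ τ hτ1 hτ).act] at hz
    have h1 := congrArg Subtype.val (DFunLike.congr_fun
      ((affineVariety_act_eq _ τ hτ1 hτ hz).trans hτ1)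
      ⟨torusChar e ξ (Ψ * 1), torusChar_mem e ξ Ψ 1⟩)
    have h2 := torusAct_torusChar e ξ z 0 (Ψ * 1)
    rw [pow_zero, pow_zero, one_mul] at h2
    have h3 : (ZMod.stdAddChar (z * Polynomial.aeval (ξ : ZMod q) (Ψ * 1)) : ℂ) •
        (torusChar e ξ (Ψ * 1) : TorusRing (q - 1)) = torusChar e ξ (Ψ * 1) := h2.symm.trans h1
    rw [Algebra.smul_def, mul_eq_right₀ (Units.ne_zero _)] at h3
    have h4 := (algebraMap ℂ (TorusRing (q - 1))).injective (h3.trans (map_one _).symm)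
    have h5 := ZMod.injective_stdAddChar (h4.trans (AddChar.map_zero_eq_one _).symm)
    rw [mul_one] at h5
    exact (mul_eq_zero.mp h5).resolve_right hΨ
  · change topologicalKrullDim (PrimeSpectrum (quotientTorusRing e ξ Ψ)) ≤ _
    rw [PrimeSpectrum.topologicalKrullDim_eq_ringKrullDim]
    calc ringKrullDim (quotientTorusRing e ξ Ψ)
        ≤ ringKrullDim (TorusRing (q - 1).totient) := ringKrullDim_le_of_surjective _ hsurj
      _ ≤ ringKrullDim (MvPolynomial (Fin (q - 1).totient) ℂ) :=
        ringKrullDim_le_of_isLocalization _ (Submonoid.powers (∏ i, MvPolynomial.X i))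
      _ = (q - 1).totient := by
        rw [MvPolynomial.ringKrullDim_of_isNoetherianRing, ringKrullDim_eq_zero_of_field]
        simp

theorem mainTheorem2 (ε : ℝ) (hε : 0 < ε) :
    (∃ (G : Type) (_ : Group G) (_ : Finite G), Nontrivial G ∧
      (essentialDim G : ℝ) / (representationDim G : ℝ) < ε) ∧
    ∃ r₀ : ℕ, ∀ r : ℕ, r₀ ≤ r →
      (∃ q : ℕ, q.Prime ∧ q ≡ 1 [MOD ∏ i ∈ Finset.range r, Nat.nth Nat.Prime i]) ∧
      ∀ q : ℕ, q.Prime → q ≡ 1 [MOD ∏ i ∈ Finset.range r, Nat.nth Nat.Prime i] →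
        Finite (CqSemidirect q) ∧
        representationDim (CqSemidirect q) = q - 1 ∧
        essentialDim (CqSemidirect q) ≤ Nat.totient (q - 1) ∧
        (essentialDim (CqSemidirect q) : ℝ) / (representationDim (CqSemidirect q) : ℝ) < ε := by
  obtain ⟨r₀, hr₀⟩ := Filter.eventually_atTop.mp
    (tendsto_prod_one_sub_inv_prime.eventually (gt_mem_nhds hε))
  have hexists : ∀ r : ℕ,
      ∃ q : ℕ, q.Prime ∧ q ≡ 1 [MOD ∏ i ∈ Finset.range r, Nat.nth Nat.Prime i] := by
    intro r
    obtain ⟨q, hq, -, hmod⟩ := Nat.exists_prime_gt_modEq_one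
      (k := ∏ i ∈ Finset.range r, Nat.nth Nat.Prime i) 0
      (Finset.prod_ne_zero_iff.mpr fun i _ => (Nat.prime_nth_prime i).ne_zero)
    exact ⟨q, hq, hmod⟩
  have hmain : ∀ r : ℕ, r₀ ≤ r → ∀ q : ℕ, q.Prime →
      q ≡ 1 [MOD ∏ i ∈ Finset.range r, Nat.nth Nat.Prime i] →
        Finite (CqSemidirect q) ∧
        representationDim (CqSemidirect q) = q - 1 ∧
        essentialDim (CqSemidirect q) ≤ Nat.totient (q - 1) ∧
        (essentialDim (CqSemidirect q) : ℝ) / (representationDim (CqSemidirect q) : ℝ) < ε := by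
    intro r hr q hq hmod
    have : Fact q.Prime := ⟨hq⟩
    have : Finite (Multiplicative (ZMod q)) := inferInstanceAs (Finite (ZMod q))
    refine ⟨Finite.of_equiv _ SemidirectProduct.equivProd.symm, representationDim_CqSemidirect hq,
      essentialDim_CqSemidirect_le hq, ?_⟩
    rw [representationDim_CqSemidirect hq]
    calc (essentialDim (CqSemidirect q) : ℝ) / ((q - 1 : ℕ) : ℝ)
        ≤ (Nat.totient (q - 1) : ℝ) / ((q - 1 : ℕ) : ℝ) := by
          gcongr
          exact essentialDim_CqSemidirect_le hq
      _ ≤ ∏ i ∈ Finset.range r, (1 - (Nat.nth Nat.Prime i : ℝ)⁻¹) :=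
          totient_div_le_prod (Nat.sub_pos_of_lt hq.one_lt).ne'
            ((Nat.modEq_iff_dvd' hq.one_le).mp hmod.symm)
      _ < ε := hr₀ r hr
  refine ⟨?_, r₀, fun r hr => ⟨hexists r, hmain r hr⟩⟩
  obtain ⟨q, hq, hmod⟩ := hexists r₀
  obtain ⟨hfin, -, -, hlt⟩ := hmain r₀ le_rfl q hq hmod
  have : Fact q.Prime := ⟨hq⟩
  have : Nontrivial (Multiplicative (ZMod q)) := inferInstanceAs (Nontrivial (ZMod q))
  exact ⟨CqSemidirect q, inferInstance, hfin,
    (SemidirectProduct.inl_injective (φ := unitsAct q)).nontrivial, hlt⟩
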